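/- For a positive integer $n$ and a coloring of $[1,n]=\{1,\dots,n\}$ with two colors, red and blue, consider the ordered triples $(x,y,z)$ of (not necessarily distinct) elements of $[1,n]$ with $x+2y=z$. Such a triple is monochromatic if $x,y,z$ all have the same color, and non-monochromatic otherwise. Theorem. Over all 2-colorings of $[1,n]$, the minimum number of monochromatic triples $(x,y,x+2y)$ is $\frac{n^2}{44}+O(n)$. The coloring $[R^{3n/11},B^{7n/11},R^{n/11}]$, in which $i\in[1,n]$ is blue if $\frac{3n}{11}<i\le\frac{10n}{11}$ and red otherwise, attains this minimum up to $O(n)$: it has $\frac{n^2}{44}+O(n)$ monochromatic triples. Moreover, every 2-coloring of $[1,n]$ has at most $\frac{5n^2}{22}+O(n)$ non-monochromatic triples. All implied constants are absolute; in particular they do not depend on the coloring. -/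

import Mathlib

/-- The two colors: red and blue. -/
inductive Color where
  | red
  | blue
deriving DecidableEq

/-- A 2-coloring of `[1,n] = {1, …, n}`. -/
abbrev Coloring (n : ℕ) : Type := Finset.Icc 1 n → Color

/-- The ordered triples `(x, y, z)` of elements of `[1,n]` with `x + 2y = z`
(equal entries are allowed). -/
def triples (n : ℕ) : Finset (Finset.Icc 1 n × Finset.Icc 1 n × Finset.Icc 1 n) :=
  Finset.univ.filter fun t => (t.1 : ℕ) + 2 * (t.2.1 : ℕ) = (t.2.2 : ℕ)

/-- The triples whose three entries all have the same color. -/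
def monoTriples {n : ℕ} (c : Coloring n) :
    Finset (Finset.Icc 1 n × Finset.Icc 1 n × Finset.Icc 1 n) :=
  (triples n).filter fun t => c t.1 = c t.2.1 ∧ c t.2.1 = c t.2.2

/-- The triples whose three entries do not all have the same color. -/
def nonMonoTriples {n : ℕ} (c : Coloring n) :
    Finset (Finset.Icc 1 n × Finset.Icc 1 n × Finset.Icc 1 n) :=
  (triples n).filter fun t => ¬(c t.1 = c t.2.1 ∧ c t.2.1 = c t.2.2)

/-- The minimum, over all 2-colorings of `[1,n]`, of the number of monochromatic triples. -/
noncomputable def minMono (n : ℕ) : ℕ :=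
  sInf (Set.range fun c : Coloring n => (monoTriples c).card)

/-- `minMono n` is a genuine minimum: it is attained and is a lower bound. -/
theorem minMono_isLeast (n : ℕ) :
    IsLeast (Set.range fun c : Coloring n => (monoTriples c).card) (minMono n) :=
  ⟨Nat.sInf_mem ⟨_, fun _ => Color.red, rfl⟩, fun _ h => Nat.sInf_le h⟩

/-- The block coloring `[R^{3n/11}, B^{7n/11}, R^{n/11}]`: an integer `i` is blue exactly when
`3n/11 < i ≤ 10n/11`. -/
def blockColoring (n : ℕ) : Coloring n := fun i =>
  if 3 * n < 11 * (i : ℕ) ∧ 11 * (i : ℕ) ≤ 10 * n then Color.blue else Color.red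

open Finset

/-! Give the colors the values ±1, with prefix sums F, and shrink the interval to [1, N] with N =
4k. Four times the monochromatic indicator is 1 + f(x)f(y) + f(y)f(z) + f(x)f(z). With σ = F(N/2)
and S = F(N), summing gives the number of triples, an equal-parity correlation of at least about
S²/4, the product Sσ, and Σ f(y)(F(N-2y) - F(2y)) (`tripleSum_eq`). The last factor is odd under y ↦
N/2 - y, so only pairs with f(y) ≠ f(N/2-y) contribute. Since F is 1-Lipschitz, each window is
bounded in terms of S and σ, and at least about |σ|/2 pairs agree and are saved
(`sum_abs_diff_mul_window_le`). A quadratic inequality in S and σ remains, tight at the block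
coloring (`quadratic_bound`). For that coloring the monochromatic triples lie in three triangles.
The non-monochromatic bound is the total n²/4 minus n²/44. -/

/-! ### Prefix sums and equal-parity correlations. -/

/-- The prefix sums `f 1 + ⋯ + f m`. -/
def prefixSum (f : ℕ → ℝ) (m : ℕ) : ℝ := ∑ i ∈ range m, f (i + 1)

lemma prefixSum_zero (f : ℕ → ℝ) : prefixSum f 0 = 0 := by simp [prefixSum]

lemma prefixSum_add (f : ℕ → ℝ) (a b : ℕ) :
    prefixSum f (a + b) = prefixSum f a + ∑ i ∈ range b, f (i + 1 + a) := by
  unfold prefixSum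
  rw [sum_range_add]
  congr 1
  exact sum_congr rfl fun i _ => by congr 1; ring

lemma prefixSum_neg (f : ℕ → ℝ) (m : ℕ) : prefixSum (fun i => -f i) m = -prefixSum f m := by
  simp [prefixSum]

lemma abs_prefixSum_sub_le {f : ℕ → ℝ} (hf : ∀ i, |f i| ≤ 1) {a b : ℕ} (hab : a ≤ b) :
    |prefixSum f b - prefixSum f a| ≤ (b : ℝ) - a := by
  obtain ⟨d, rfl⟩ := Nat.exists_eq_add_of_le hab
  rw [prefixSum_add, add_sub_cancel_left]
  refine (abs_sum_le_sum_abs _ _).trans ?_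
  calc ∑ i ∈ range d, |f (i + 1 + a)| ≤ ∑ _i ∈ range d, (1 : ℝ) := sum_le_sum fun i _ => hf _
    _ = _ := by simp

/-- Sum over all pairs of equal parity in `[1, 2m]`. -/
lemma sum_same_parity {f : ℕ → ℝ} (hf : ∀ i, f i = 1 ∨ f i = -1) (m : ℕ) :
    ∑ j ∈ range m, ∑ i ∈ range (2 * m - 2 * (j + 1)), f (i + 1) * f (i + 1 + 2 * (j + 1)) =
      ((∑ j ∈ range m, f (2 * j + 1)) ^ 2 + (∑ j ∈ range m, f (2 * j + 2)) ^ 2) / 2 - m := by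
  induction m with
  | zero => simp
  | succ m ih =>
    have hsq : ∀ i, f i ^ 2 = 1 := fun i => by rcases hf i with h | h <;> simp [h]
    have key : ∑ j ∈ range (m + 1), ∑ i ∈ range (2 * (m + 1) - 2 * (j + 1)),
          f (i + 1) * f (i + 1 + 2 * (j + 1)) =
        ∑ j ∈ range m, ∑ i ∈ range (2 * m - 2 * (j + 1)), f (i + 1) * f (i + 1 + 2 * (j + 1)) +
        ∑ j ∈ range m, (f (2 * (m - 1 - j) + 1) * f (2 * m + 1) +
          f (2 * (m - 1 - j) + 2) * f (2 * m + 2)) := by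
      rw [sum_range_succ, Nat.sub_self, sum_range_zero, add_zero, ← sum_add_distrib]
      refine sum_congr rfl fun j hj => ?_
      obtain ⟨d, rfl⟩ := Nat.exists_eq_add_of_lt (mem_range.1 hj)
      rw [show 2 * (j + d + 1 + 1) - 2 * (j + 1) = 2 * d + 1 + 1 by omega,
        show 2 * (j + d + 1) - 2 * (j + 1) = 2 * d by omega,
        show j + d + 1 - 1 - j = d by omega, sum_range_succ, sum_range_succ,
        show 2 * d + 1 + 2 * (j + 1) = 2 * (j + d + 1) + 1 by ring,
        show 2 * d + 1 + 1 + 2 * (j + 1) = 2 * (j + d + 1) + 2 by ring, add_assoc]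
    rw [key, ih, sum_add_distrib, ← sum_mul, ← sum_mul,
      sum_range_reflect (fun j => f (2 * j + 1)) m, sum_range_reflect (fun j => f (2 * j + 2)) m,
      sum_range_succ, sum_range_succ]
    push_cast
    linear_combination (-1 / 2) * hsq (2 * m + 1) - (1 / 2) * hsq (2 * m + 2)

lemma prefixSum_two_mul (f : ℕ → ℝ) (m : ℕ) :
    prefixSum f (2 * m) = ∑ j ∈ range m, f (2 * j + 1) + ∑ j ∈ range m, f (2 * j + 2) := by
  unfold prefixSum
  induction m with
  | zero => simp
  | succ m ih =>
    rw [show 2 * (m + 1) = 2 * m + 1 + 1 by ring, sum_range_succ, sum_range_succ, ih,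
      sum_range_succ, sum_range_succ]
    ring

lemma le_sum_same_parity {f : ℕ → ℝ} (hf : ∀ i, f i = 1 ∨ f i = -1) (m : ℕ) :
    prefixSum f (2 * m) ^ 2 / 4 - m ≤
      ∑ j ∈ range m, ∑ i ∈ range (2 * m - 2 * (j + 1)),
        f (i + 1) * f (i + 1 + 2 * (j + 1)) := by
  rw [sum_same_parity hf, prefixSum_two_mul]
  nlinarith [sq_nonneg (∑ j ∈ range m, f (2 * j + 1) - ∑ j ∈ range m, f (2 * j + 2))]

/-! ### Discrete integrals, folding, and window bounds. -/

/-- In steps of 2, t|t|/4 telescopes to |t| with an error of at most 1 per step. -/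
lemma le_sum_abs_sub (c : ℝ) (k : ℕ) :
    ((2 * k - c) * |2 * k - c| + c * |c|) / 4 - k ≤ ∑ j ∈ range k, |2 * ((j : ℝ) + 1) - c| := by
  induction k with
  | zero => simp
  | succ k ih =>
    rw [sum_range_succ]
    have key : ∀ t : ℝ, (t * |t| - (t - 2) * |t - 2|) / 4 - 1 ≤ |t| := fun t => by
      rcases abs_cases t with ⟨h, h'⟩ | ⟨h, h'⟩ <;>
        rcases abs_cases (t - 2) with ⟨g, g'⟩ | ⟨g, g'⟩ <;> rw [h, g] <;> nlinarith
    have := key (2 * (k + 1) - c)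
    rw [show 2 * ((k : ℝ) + 1) - c - 2 = 2 * k - c by ring] at this
    push_cast
    linarith

lemma sum_max_sub_le (r : ℝ) (k : ℕ) :
    ∑ j ∈ range k, max (r - 4 * j) 0 ≤ 2 * k + r ^ 2 / 8 := by
  have key : ∀ t : ℝ, max t 0 ≤ max t 0 ^ 2 / 8 - max (t - 4) 0 ^ 2 / 8 + 2 := fun t => by
    rcases max_cases t 0 with ⟨h, h'⟩ | ⟨h, h'⟩ <;>
      rcases max_cases (t - 4) 0 with ⟨g, g'⟩ | ⟨g, g'⟩ <;> rw [h, g] <;>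
      nlinarith [sq_nonneg (t - 4)]
  have main : ∑ j ∈ range k, max (r - 4 * j) 0 ≤
      2 * k + max r 0 ^ 2 / 8 - max (r - 4 * k) 0 ^ 2 / 8 := by
    induction k with
    | zero => simp
    | succ k ih =>
      rw [sum_range_succ]
      have := key (r - 4 * k)
      rw [show r - 4 * (k : ℝ) - 4 = r - 4 * (k + 1) by ring] at this
      push_cast
      linarith
  have h1 : max r 0 ^ 2 ≤ r ^ 2 := by
    rcases max_cases r 0 with ⟨h, h'⟩ | ⟨h, h'⟩ <;> rw [h]
    nlinarith [sq_nonneg r]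
  nlinarith [sq_nonneg (max (r - 4 * k) 0)]

/-- Folding a sum over `[1, 2k]` about its midpoint. -/
lemma sum_range_fold (G : ℕ → ℝ) (k : ℕ) :
    ∑ j ∈ range (2 * k), G (j + 1) =
      ∑ j ∈ range k, (G (j + 1) + G (2 * k - (j + 1))) + G (2 * k) - G k := by
  have h1 : ∑ j ∈ range k, G (2 * k - (j + 1)) = ∑ j ∈ range k, G (k + j) := by
    rw [← sum_range_reflect (fun j => G (k + j))]
    refine sum_congr rfl fun j hj => ?_
    have := mem_range.1 hj
    congr 1; omega
  have h2 := sum_range_succ (fun j => G (k + j)) k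
  rw [sum_range_succ'] at h2
  rw [two_mul k, sum_range_add, sum_add_distrib, ← two_mul k, h1]
  simp only [add_zero, ← two_mul, ← add_assoc] at h2 ⊢
  linarith

/-- The window `(u, 2h - u]` of the prefix sums, bounded through `F h = σ` and `F (2h) = S ≤ 0`. -/
lemma abs_window_le {h u σ S A B : ℝ} (hS : S ≤ 0) (h1 : |σ - A| ≤ h - u) (h2 : |B - σ| ≤ h - u)
    (h3 : |A| ≤ u) (h4 : |S - B| ≤ u) :
    |B - A| ≤ ((h - σ) / 2 - |u - (h + σ) / 2|) + ((h - (S - σ)) / 2 - |u - (h + (S - σ)) / 2|) := by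
  -- The tents are min(h-u, u-σ) and min(h-u, u-(S-σ)), the Lipschitz bounds on A - σ and σ - B. The
  -- opposite sign of B - A gives no more because S ≤ 0.
  rw [abs_le] at *
  obtain ⟨a1, a2⟩ := h1
  obtain ⟨b1, b2⟩ := h2
  obtain ⟨c1, c2⟩ := h3
  obtain ⟨d1, d2⟩ := h4
  rcases abs_cases (u - (h + σ) / 2) with ⟨e, e'⟩ | ⟨e, e'⟩ <;>
    rcases abs_cases (u - (h + (S - σ)) / 2) with ⟨g, g'⟩ | ⟨g, g'⟩ <;> rw [e, g] <;>
    constructor <;> linarith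

/-- Bounds from below what is saved when f(y) and f(2k-y) agree. -/
lemma min_le_window {h u σ S : ℝ} (hu0 : 0 ≤ u) (hσ : |σ| ≤ h) (hs : |S - σ| ≤ h) :
    min (-S) (2 * h - 2 * u) ≤
      ((h - σ) / 2 - |u - (h + σ) / 2|) + ((h - (S - σ)) / 2 - |u - (h + (S - σ)) / 2|) := by
  rw [abs_le] at hσ hs
  obtain ⟨a1, a2⟩ := hσ
  obtain ⟨b1, b2⟩ := hs
  rw [min_le_iff]
  rcases abs_cases (u - (h + σ) / 2) with ⟨e, e'⟩ | ⟨e, e'⟩ <;>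
    rcases abs_cases (u - (h + (S - σ)) / 2) with ⟨g, g'⟩ | ⟨g, g'⟩ <;> rw [e, g] <;>
    first | (left; linarith) | (right; linarith)

/-- The block coloring has S = -3N/11 and σ = N/22, where both squares of the first case vanish and
r = N/11 = 2|σ| maximizes r|σ| - r²/4. For small -S no saving is needed. -/
lemma quadratic_bound {N S σ r : ℝ} (hN : 0 ≤ N)
    (hr : (N / 11 ≤ -S ∧ r = N / 11) ∨ (-S ≤ N / 11 ∧ r = 0)) :
    N ^ 2 / 11 ≤ N ^ 2 / 8 + S ^ 2 / 4 + S * σ + N * S / 4 + (σ ^ 2 + (S - σ) ^ 2) / 4 +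
      r * |σ| - r ^ 2 / 4 := by
  rcases hr with ⟨_, rfl⟩ | ⟨h, rfl⟩
  · have : N / 11 * σ ≤ N / 11 * |σ| := mul_le_mul_of_nonneg_left (le_abs_self σ) (by positivity)
    nlinarith [sq_nonneg (σ + S / 2 + N / 11), sq_nonneg (S + 3 * N / 11)]
  · nlinarith [sq_nonneg (σ + S / 2), sq_nonneg S, mul_le_mul_of_nonneg_left h hN]

/-- The sum of `f` over the window `(2y, 4k - 2y]`, weighted by `|f(y) - f(2k - y)|`. -/
lemma sum_abs_diff_mul_window_le {f : ℕ → ℝ} (hf : ∀ i, f i = 1 ∨ f i = -1) (k : ℕ) {r : ℝ}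
    (hr0 : 0 ≤ r) (hr : r ≤ -prefixSum f (4 * k)) :
    ∑ j ∈ range k, |(f (j + 1) - f (2 * k - (j + 1))) *
        (prefixSum f (4 * k - 2 * (j + 1)) - prefixSum f (2 * (j + 1)))| ≤
      2 * k ^ 2 - k * prefixSum f (4 * k) -
        (prefixSum f (2 * k) ^ 2 + (prefixSum f (4 * k) - prefixSum f (2 * k)) ^ 2) / 4 -
        r * |prefixSum f (2 * k)| + r ^ 2 / 4 + 8 * k + 2 * r := by
  have hf1 : ∀ i, |f i| ≤ 1 := fun i => by rcases hf i with h | h <;> simp [h]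
  set S := prefixSum f (4 * k) with hS
  set σ := prefixSum f (2 * k) with hσ
  have hσ' : |σ| ≤ 2 * k := by
    simpa [prefixSum_zero] using abs_prefixSum_sub_le hf1 (Nat.zero_le (2 * k))
  have hs' : |S - σ| ≤ 2 * k := by
    have := abs_prefixSum_sub_le hf1 (show 2 * k ≤ 4 * k by omega)
    push_cast at this
    linarith
  set c₁ : ℝ := (2 * k + σ) / 2 with hc₁
  set c₂ : ℝ := (2 * k + (S - σ)) / 2 with hc₂
  -- With y = j + 1, an agreeing pair saves at least 2 min(r, 4(k-y)); the `max` term corrects 2r to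
  -- this near y = k.
  have pointwise : ∀ j ∈ range k, |(f (j + 1) - f (2 * k - (j + 1))) *
        (prefixSum f (4 * k - 2 * (j + 1)) - prefixSum f (2 * (j + 1)))| ≤
      (2 * (2 * k) - S) - 2 * |2 * ((j : ℝ) + 1) - c₁| - 2 * |2 * ((j : ℝ) + 1) - c₂| -
        r * |f (j + 1) + f (2 * k - (j + 1))| + 2 * max (r - 4 * ((k - 1 - j : ℕ) : ℝ)) 0 := by
    intro j hj
    have hj := mem_range.1 hj
    have hjk : (j : ℝ) + 1 ≤ k := by exact_mod_cast hj
    have h1 := abs_prefixSum_sub_le hf1 (show 2 * (j + 1) ≤ 2 * k by omega)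
    have h2 := abs_prefixSum_sub_le hf1 (show 2 * k ≤ 4 * k - 2 * (j + 1) by omega)
    have h3 := abs_prefixSum_sub_le hf1 (Nat.zero_le (2 * (j + 1)))
    have h4 := abs_prefixSum_sub_le hf1 (show 4 * k - 2 * (j + 1) ≤ 4 * k by omega)
    rw [Nat.cast_sub (by omega)] at h2 h4
    rw [prefixSum_zero] at h3
    push_cast at h1 h2 h3 h4
    have hW := abs_window_le (h := 2 * k) (u := 2 * ((j : ℝ) + 1)) (σ := σ) (S := S) (by linarith)
      h1 (by linarith) (by simpa using h3) (by linarith)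
    have hE := min_le_window (h := 2 * k) (u := 2 * ((j : ℝ) + 1)) (by positivity) hσ' hs'
    rw [← hc₁, ← hc₂] at hW hE
    set W := prefixSum f (4 * k - 2 * (j + 1)) - prefixSum f (2 * (j + 1))
    have hcast : ((k - 1 - j : ℕ) : ℝ) = k - 1 - j := by
      rw [Nat.sub_sub, Nat.cast_sub (by omega)]; push_cast; ring
    rw [hcast, abs_mul]
    have hm : r - max (r - 4 * ((k : ℝ) - 1 - j)) 0 ≤ min (-S) (2 * (2 * k) - 2 * (2 * (j + 1))) :=
      le_min (by linarith [le_max_right (r - 4 * ((k : ℝ) - 1 - j)) 0])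
        (by linarith [le_max_left (r - 4 * ((k : ℝ) - 1 - j)) 0])
    have hm0 := le_max_right (r - 4 * ((k : ℝ) - 1 - j)) 0
    rcases hf (j + 1) with a | a <;> rcases hf (2 * k - (j + 1)) with b | b <;> rw [a, b] <;>
      norm_num <;> linarith
  -- The 2 pays for the fold's boundary terms f(2k) and f(k).
  have hp : |σ| ≤ ∑ j ∈ range k, |f (j + 1) + f (2 * k - (j + 1))| + 2 := by
    have h : σ = _ := sum_range_fold f k
    have e := abs_sum_le_sum_abs (fun j => f (j + 1) + f (2 * k - (j + 1))) (range k)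
    have e1 := hf1 (2 * k)
    have e2 := hf1 k
    rw [abs_le] at e e1 e2
    rw [h, abs_le]
    constructor <;> linarith
  have hq : ∑ j ∈ range k, max (r - 4 * ((k - 1 - j : ℕ) : ℝ)) 0 ≤ 2 * k + r ^ 2 / 8 := by
    rw [sum_range_reflect (fun j => max (r - 4 * (j : ℝ)) 0)]
    exact sum_max_sub_le r k
  have habs : ∀ τ : ℝ, |τ| ≤ 2 * k →
      k ^ 2 / 2 + τ ^ 2 / 8 - k ≤ ∑ j ∈ range k, |2 * ((j : ℝ) + 1) - (2 * k + τ) / 2| := by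
    intro τ hτ
    rw [abs_le] at hτ
    have := le_sum_abs_sub ((2 * k + τ) / 2) k
    rw [abs_of_nonneg (by linarith), abs_of_nonneg (by linarith)] at this
    linarith
  have g1 := habs σ hσ'
  have g2 := habs (S - σ) hs'
  rw [← hc₁] at g1
  rw [← hc₂] at g2
  have hrp := mul_le_mul_of_nonneg_left hp hr0
  refine (sum_le_sum pointwise).trans ?_
  rw [sum_add_distrib, sum_sub_distrib, sum_sub_distrib, sum_sub_distrib, ← mul_sum, ← mul_sum,
    ← mul_sum, ← mul_sum, sum_const, card_range, nsmul_eq_mul]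
  linarith

lemma sum_window_eq {f : ℕ → ℝ} (k : ℕ) :
    ∑ j ∈ range (2 * k),
        f (j + 1) * (prefixSum f (4 * k - 2 * (j + 1)) - prefixSum f (2 * (j + 1))) =
      ∑ j ∈ range k, (f (j + 1) - f (2 * k - (j + 1))) *
        (prefixSum f (4 * k - 2 * (j + 1)) - prefixSum f (2 * (j + 1))) -
        f (2 * k) * prefixSum f (4 * k) := by
  rw [sum_range_fold (fun y => f y * (prefixSum f (4 * k - 2 * y) - prefixSum f (2 * y)))]
  have h2 : 4 * k - 2 * k = 2 * k := by omega
  have h3 : 2 * (2 * k) = 4 * k := by ring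
  simp only [h2, h3, Nat.sub_self, prefixSum_zero, sub_self, mul_zero, sub_zero, zero_sub, mul_neg]
  rw [← sub_eq_add_neg]
  congr 1
  refine sum_congr rfl fun j hj => ?_
  have := mem_range.1 hj
  rw [show 4 * k - 2 * (2 * k - (j + 1)) = 2 * (j + 1) by omega,
    show 2 * (2 * k - (j + 1)) = 4 * k - 2 * (j + 1) by omega]
  ring

/-! ### The lower bound for ±1 sequences. -/

/-- Four times the number of monochromatic triples of the coloring `f` of `[1, 4k]`. -/
def tripleSum (f : ℕ → ℝ) (k : ℕ) : ℝ :=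
  ∑ j ∈ range (2 * k), ∑ i ∈ range (4 * k - 2 * (j + 1)),
    (1 + f (i + 1) * f (j + 1) + f (j + 1) * f (i + 1 + 2 * (j + 1)) +
      f (i + 1) * f (i + 1 + 2 * (j + 1)))

lemma tripleSum_neg (f : ℕ → ℝ) (k : ℕ) : tripleSum (fun i => -f i) k = tripleSum f k := by
  simp [tripleSum]

lemma tripleSum_eq (f : ℕ → ℝ) (k : ℕ) :
    tripleSum f k = 4 * k ^ 2 - 2 * k +
      ∑ j ∈ range (2 * k), ∑ i ∈ range (4 * k - 2 * (j + 1)),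
        f (i + 1) * f (i + 1 + 2 * (j + 1)) +
      prefixSum f (4 * k) * prefixSum f (2 * k) +
      ∑ j ∈ range (2 * k),
        f (j + 1) * (prefixSum f (4 * k - 2 * (j + 1)) - prefixSum f (2 * (j + 1))) := by
  have hcount : ∑ j ∈ range (2 * k), ((4 * k - 2 * (j + 1) : ℕ) : ℝ) = 4 * k ^ 2 - 2 * k := by
    have e : ∀ j ∈ range (2 * k), ((4 * k - 2 * (j + 1) : ℕ) : ℝ) = 4 * k - 2 * (j + 1) :=
      fun j hj => by
        have := mem_range.1 hj
        rw [Nat.cast_sub (by omega)]; push_cast; ring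
    have g : ∀ m : ℕ, ∑ j ∈ range m, (4 * (k : ℝ) - 2 * (j + 1)) = 4 * k * m - m * (m + 1) := by
      intro m
      induction m with
      | zero => simp
      | succ m ih => rw [sum_range_succ, ih]; push_cast; ring
    rw [sum_congr rfl e, g]; push_cast; ring
  have hS : prefixSum f (4 * k) * prefixSum f (2 * k) =
      ∑ j ∈ range (2 * k), f (j + 1) * prefixSum f (4 * k) := by
    rw [← sum_mul, mul_comm]; rfl
  rw [← hcount, hS, ← sum_add_distrib, ← sum_add_distrib, ← sum_add_distrib, tripleSum]
  refine sum_congr rfl fun j hj => ?_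
  have := mem_range.1 hj
  have hadd := prefixSum_add f (2 * (j + 1)) (4 * k - 2 * (j + 1))
  rw [show 2 * (j + 1) + (4 * k - 2 * (j + 1)) = 4 * k by omega] at hadd
  rw [hadd, sum_add_distrib, sum_add_distrib, sum_add_distrib, ← sum_mul, ← mul_sum, sum_const,
    card_range, nsmul_eq_mul, mul_one]
  change _ + prefixSum f _ * _ + _ + _ = _
  ring

lemma le_tripleSum {f : ℕ → ℝ} (hf : ∀ i, f i = 1 ∨ f i = -1) (k : ℕ) :
    16 * (k : ℝ) ^ 2 / 11 - 20 * k ≤ tripleSum f k := by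
  wlog hS : prefixSum f (4 * k) ≤ 0 generalizing f
  · rw [← tripleSum_neg]
    refine this (fun i => ?_) ?_
    · rcases hf i with h | h <;> simp [h]
    · rw [prefixSum_neg]; linarith
  have hf1 : ∀ i, |f i| ≤ 1 := fun i => by rcases hf i with h | h <;> simp [h]
  have hA := le_sum_same_parity hf (2 * k)
  rw [show 2 * (2 * k) = 4 * k by ring] at hA
  have hk : (0 : ℝ) ≤ k := k.cast_nonneg
  obtain ⟨r, hr0, hr, hrk, hcase⟩ : ∃ r : ℝ, 0 ≤ r ∧ r ≤ -prefixSum f (4 * k) ∧ r ≤ 4 * k / 11 ∧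
      ((4 * k / 11 ≤ -prefixSum f (4 * k) ∧ r = 4 * k / 11) ∨
        (-prefixSum f (4 * k) ≤ 4 * k / 11 ∧ r = 0)) := by
    rcases le_total (4 * k / 11 : ℝ) (-prefixSum f (4 * k)) with h | h
    · exact ⟨4 * k / 11, by positivity, h, le_rfl, Or.inl ⟨h, rfl⟩⟩
    · exact ⟨0, le_rfl, by linarith, by positivity, Or.inr ⟨h, rfl⟩⟩
  have hD := sum_abs_diff_mul_window_le hf k hr0 hr
  have hD' := (abs_le.1 (abs_sum_le_sum_abs (fun j => (f (j + 1) - f (2 * k - (j + 1))) *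
    (prefixSum f (4 * k - 2 * (j + 1)) - prefixSum f (2 * (j + 1)))) (range k))).1
  have hq := quadratic_bound (σ := prefixSum f (2 * k)) (by positivity : (0 : ℝ) ≤ 4 * k) hcase
  have hSb : |prefixSum f (4 * k)| ≤ 4 * k := by
    simpa [prefixSum_zero] using abs_prefixSum_sub_le hf1 (Nat.zero_le (4 * k))
  have hfS : f (2 * k) * prefixSum f (4 * k) ≤ 4 * k := by
    rw [abs_le] at hSb
    rcases hf (2 * k) with h | h <;> rw [h] <;> linarith
  rw [tripleSum_eq, sum_window_eq]
  push_cast at hA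
  nlinarith

/-! ### Counting triples of the block coloring. -/

lemma card_triangle_le {P : Finset (ℕ × ℕ)} (a b N : ℕ)
    (hP : ∀ p ∈ P, a ≤ p.1 ∧ b ≤ p.2 ∧ p.1 + 2 * p.2 ≤ a + 2 * b + N) :
    (P.card : ℝ) ≤ ((N : ℝ) + 2) ^ 2 / 4 := by
  have hsub : P ⊆ (range (N / 2 + 1)).biUnion fun j =>
      (range (N + 1 - 2 * j)).image fun i => (a + i, b + j) := by
    rintro ⟨x, y⟩ hp
    obtain ⟨h1, h2, h3⟩ := hP _ hp
    dsimp only at h1 h2 h3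
    simp only [mem_biUnion, mem_image, mem_range, Prod.mk.injEq]
    exact ⟨y - b, by omega, x - a, by omega, by omega, by omega⟩
  have hcard : P.card ≤ ∑ j ∈ range (N / 2 + 1), (N + 1 - 2 * j) :=
    (card_le_card hsub).trans <| card_biUnion_le.trans <| sum_le_sum fun j _ =>
      card_image_le.trans (card_range _).le
  have hsum : ∑ j ∈ range (N / 2 + 1), ((N + 1 - 2 * j : ℕ) : ℝ) =
      ∑ j ∈ range (N / 2 + 1), ((N : ℝ) + 1 - 2 * j) := sum_congr rfl fun j hj => by
    have := mem_range.1 hj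
    rw [Nat.cast_sub (by omega)]; push_cast; ring
  have htel : ∀ m : ℕ, ∑ j ∈ range m, ((N : ℝ) + 1 - 2 * j) =
      (((N : ℝ) + 2) ^ 2 - (N + 2 - 2 * m) ^ 2) / 4 := fun m => by
    induction m with
    | zero => simp
    | succ m ih => rw [sum_range_succ, ih]; push_cast; ring
  have hcast : (P.card : ℝ) ≤ ∑ j ∈ range (N / 2 + 1), ((N + 1 - 2 * j : ℕ) : ℝ) := by
    exact_mod_cast hcard
  rw [hsum, htel] at hcast
  linarith [sq_nonneg ((N : ℝ) + 2 - 2 * (N / 2 + 1 : ℕ))]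

/-- The pair `(x, y)` underlying a triple `(x, y, z)`. -/
def toPair {n : ℕ} (t : Finset.Icc 1 n × Finset.Icc 1 n × Finset.Icc 1 n) : ℕ × ℕ :=
  (t.1, t.2.1)

lemma card_image_toPair {n : ℕ} {P : Finset (Finset.Icc 1 n × Finset.Icc 1 n × Finset.Icc 1 n)}
    (hP : P ⊆ triples n) : (P.image toPair).card = P.card := by
  refine card_image_of_injOn fun s hs t ht hst => ?_
  have h1 := (mem_filter.1 (hP hs)).2
  have h2 := (mem_filter.1 (hP ht)).2
  obtain ⟨h3, h4⟩ := Prod.mk.inj hst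
  exact Prod.ext (Subtype.ext h3) (Prod.ext (Subtype.ext h4) (Subtype.ext (by omega)))

lemma monoTriples_subset {n : ℕ} (c : Coloring n) : monoTriples c ⊆ triples n :=
  filter_subset _ _

lemma card_triples_le (n : ℕ) : ((triples n).card : ℝ) ≤ ((n : ℝ) + 2) ^ 2 / 4 := by
  rw [← card_image_toPair Subset.rfl]
  refine card_triangle_le 0 0 n fun p hp => ?_
  obtain ⟨t, ht, rfl⟩ := mem_image.1 hp
  have h1 := (mem_filter.1 ht).2
  have h2 := (mem_Icc.1 t.2.2.2).2
  simp only [toPair]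
  omega

lemma blockColoring_eq_blue_iff {n : ℕ} (i : Finset.Icc 1 n) :
    blockColoring n i = Color.blue ↔ 3 * n < 11 * (i : ℕ) ∧ 11 * (i : ℕ) ≤ 10 * n := by
  unfold blockColoring
  split_ifs with h <;> simp [h]

lemma card_monoTriples_blockColoring_le (n : ℕ) :
    ((monoTriples (blockColoring n)).card : ℝ) ≤ (n : ℝ) ^ 2 / 44 + 5 * n / 11 + 3 := by
  set P := (monoTriples (blockColoring n)).image toPair
  set a := 3 * n / 11 + 1 with ha
  set b := 10 * n / 11 + 1 with hb
  -- Sizes n/11, 3n/11, n/11 give (1 + 9 + 1)/(4·121) = 1/44. Red x, y ≤ 3n/11 force z ≤ 9n/11,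
  -- hence z in the first block; y > 10n/11 would give z > n.
  have hP : ∀ p ∈ P, (a ≤ p.1 ∧ a ≤ p.2 ∧ p.1 + 2 * p.2 ≤ a + 2 * a + (10 * n / 11 - 3 * a)) ∨
      p.1 + 2 * p.2 ≤ 3 * n / 11 ∨ (b ≤ p.1 ∧ p.1 + 2 * p.2 ≤ b + (n - b)) := by
    intro p hp
    obtain ⟨⟨x, y, z⟩, ht, rfl⟩ := mem_image.1 hp
    obtain ⟨h1, h2⟩ := mem_filter.1 ht
    have h3 := (mem_filter.1 h1).2
    have hz := (mem_Icc.1 z.2).2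
    have e1 := blockColoring_eq_blue_iff x
    have e2 := blockColoring_eq_blue_iff y
    have e3 := blockColoring_eq_blue_iff z
    dsimp only at h2 h3
    rw [h2.1, h2.2] at e1
    rw [h2.2] at e2
    simp only [toPair]
    by_cases hc : blockColoring n z = Color.blue
    · simp only [hc, true_iff] at e1 e2 e3
      left
      omega
    · simp only [hc, false_iff, not_and_or, not_lt, not_le] at e1 e2 e3
      right
      omega
  have hsub : P ⊆ P.filter (fun p => a ≤ p.1 ∧ a ≤ p.2 ∧
        p.1 + 2 * p.2 ≤ a + 2 * a + (10 * n / 11 - 3 * a)) ∪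
      (P.filter (fun p => p.1 + 2 * p.2 ≤ 3 * n / 11) ∪
        P.filter (fun p => b ≤ p.1 ∧ p.1 + 2 * p.2 ≤ b + (n - b))) := fun p hp => by
    simp only [mem_union, mem_filter, hp, true_and]
    exact hP p hp
  have hcard := (card_le_card hsub).trans
    ((card_union_le _ _).trans (Nat.add_le_add_left (card_union_le _ _) _))
  have h1 := card_triangle_le a a (10 * n / 11 - 3 * a) (P := P.filter _)
    fun p hp => (mem_filter.1 hp).2
  have h2 := card_triangle_le 0 0 (3 * n / 11) (P := P.filter (fun p => p.1 + 2 * p.2 ≤ 3 * n / 11))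
    fun p hp => by have := (mem_filter.1 hp).2; omega
  have h3 := card_triangle_le b 0 (n - b)
    (P := P.filter (fun p => b ≤ p.1 ∧ p.1 + 2 * p.2 ≤ b + (n - b)))
    fun p hp => by have := (mem_filter.1 hp).2; omega
  have b1 : 11 * ((10 * n / 11 - 3 * a : ℕ) : ℝ) ≤ n := by
    exact_mod_cast (by omega : 11 * (10 * n / 11 - 3 * a) ≤ n)
  have b2 : 11 * ((3 * n / 11 : ℕ) : ℝ) ≤ 3 * n := by
    exact_mod_cast (by omega : 11 * (3 * n / 11) ≤ 3 * n)
  have b3 : 11 * ((n - b : ℕ) : ℝ) ≤ n := by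
    exact_mod_cast (by omega : 11 * (n - b) ≤ n)
  have hsq : ∀ s t : ℝ, 0 ≤ s → 11 * s ≤ t → (s + 2) ^ 2 / 4 ≤ (t / 11 + 2) ^ 2 / 4 :=
    fun s t hs hst => by
      have : s + 2 ≤ t / 11 + 2 := by linarith
      gcongr
  replace h1 := h1.trans (hsq _ _ (Nat.cast_nonneg _) b1)
  replace h2 := h2.trans (hsq _ _ (Nat.cast_nonneg _) b2)
  replace h3 := h3.trans (hsq _ _ (Nat.cast_nonneg _) b3)
  rw [← card_image_toPair (monoTriples_subset _)]
  have hcast : (P.card : ℝ) ≤ _ := Nat.cast_le.2 hcard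
  push_cast at hcast
  refine hcast.trans ((add_le_add h1 (add_le_add h2 h3)).trans (le_of_eq ?_))
  ring

/-! ### From ±1 sequences back to colorings. -/

/-- The `±1`-valued function of a coloring, extended by `1` outside `[1, n]`. -/
def Coloring.sign {n : ℕ} (c : Coloring n) (i : ℕ) : ℝ :=
  if h : i ∈ Finset.Icc 1 n then (if c ⟨i, h⟩ = Color.red then 1 else -1) else 1

lemma Coloring.sign_eq_or {n : ℕ} (c : Coloring n) (i : ℕ) : c.sign i = 1 ∨ c.sign i = -1 := by
  unfold Coloring.sign
  split_ifs <;> simp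

lemma Coloring.eq_of_sign_eq {n : ℕ} (c : Coloring n) {i j : ℕ} (hi : i ∈ Finset.Icc 1 n)
    (hj : j ∈ Finset.Icc 1 n) (h : c.sign i = c.sign j) : c ⟨i, hi⟩ = c ⟨j, hj⟩ := by
  unfold Coloring.sign at h
  rw [dif_pos hi, dif_pos hj] at h
  cases hci : c ⟨i, hi⟩ <;> cases hcj : c ⟨j, hj⟩ <;> simp [hci, hcj] at h ⊢ <;> norm_num at h

lemma tripleSum_sign_le {n k : ℕ} (hk : 4 * k ≤ n) (c : Coloring n) :
    tripleSum c.sign k ≤ 4 * (monoTriples c).card := by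
  set I := (range (2 * k)).sigma fun j => range (4 * k - 2 * (j + 1))
  set Q := I.filter fun p => c.sign (p.2 + 1) = c.sign (p.1 + 1) ∧
    c.sign (p.1 + 1) = c.sign (p.2 + 1 + 2 * (p.1 + 1)) with hQ
  have hsum : tripleSum c.sign k = 4 * Q.card := by
    rw [tripleSum, sum_sigma', hQ, card_filter, Nat.cast_sum, mul_sum]
    refine sum_congr rfl fun p _ => ?_
    rcases c.sign_eq_or (p.2 + 1) with h1 | h1 <;> rcases c.sign_eq_or (p.1 + 1) with h2 | h2 <;>
      rcases c.sign_eq_or (p.2 + 1 + 2 * (p.1 + 1)) with h3 | h3 <;> rw [h1, h2, h3] <;> norm_num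
  have hcard : Q.card ≤ ((monoTriples c).image toPair).card := by
    refine card_le_card_of_injOn (fun p => (p.2 + 1, p.1 + 1)) (fun p hp => ?_)
      fun p _ q _ hpq => ?_
    · obtain ⟨hI, h1, h2⟩ := mem_filter.1 hp
      obtain ⟨hj, hi⟩ := mem_sigma.1 hI
      have hj := mem_range.1 hj
      have hi := mem_range.1 hi
      have mx : p.2 + 1 ∈ Finset.Icc 1 n := mem_Icc.2 (by omega)
      have my : p.1 + 1 ∈ Finset.Icc 1 n := mem_Icc.2 (by omega)
      have mz : p.2 + 1 + 2 * (p.1 + 1) ∈ Finset.Icc 1 n := mem_Icc.2 (by omega)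
      refine mem_coe.2 (mem_image.2 ⟨(⟨_, mx⟩, ⟨_, my⟩, ⟨_, mz⟩), ?_, rfl⟩)
      exact mem_filter.2 ⟨mem_filter.2 ⟨mem_univ _, rfl⟩, c.eq_of_sign_eq mx my h1,
        c.eq_of_sign_eq my mz h2⟩
    · obtain ⟨i, j⟩ := p
      obtain ⟨i', j'⟩ := q
      simp only [Prod.mk.injEq, Nat.add_right_cancel_iff] at hpq
      obtain ⟨rfl, rfl⟩ := hpq
      rfl
  rw [card_image_toPair (monoTriples_subset _)] at hcard
  rw [hsum]
  exact_mod_cast Nat.mul_le_mul_left 4 hcard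

lemma le_card_monoTriples {n : ℕ} (c : Coloring n) :
    (n : ℝ) ^ 2 / 44 - 2 * n ≤ (monoTriples c).card := by
  -- Dropping at most 3 points makes the length a multiple of 4, at a cost of O(n).
  have h1 := le_tripleSum c.sign_eq_or (n / 4)
  have h2 := tripleSum_sign_le (k := n / 4) (by omega) c
  have h3 : 4 * ((n / 4 : ℕ) : ℝ) ≤ n := by exact_mod_cast (by omega : 4 * (n / 4) ≤ n)
  have h4 : (n : ℝ) ≤ 4 * ((n / 4 : ℕ) : ℝ) + 3 := by
    exact_mod_cast (by omega : n ≤ 4 * (n / 4) + 3)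
  generalize ((n / 4 : ℕ) : ℝ) = k at *
  rcases Nat.eq_zero_or_pos n with rfl | hn
  · simp
  · have hn : (1 : ℝ) ≤ n := by exact_mod_cast hn
    rcases le_total (3 : ℝ) n with h | h <;> nlinarith

theorem mainTheorem2 :
    ∃ C : ℝ, ∀ n : ℕ,
      |(minMono n : ℝ) - (n : ℝ) ^ 2 / 44| ≤ C * (n : ℝ) ∧
      |((monoTriples (blockColoring n)).card : ℝ) - (n : ℝ) ^ 2 / 44| ≤ C * (n : ℝ) ∧
      ∀ c : Coloring n,
        ((nonMonoTriples c).card : ℝ) ≤ 5 * (n : ℝ) ^ 2 / 22 + C * (n : ℝ) := by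
  refine ⟨4, fun n => ?_⟩
  obtain ⟨⟨c₀, hc₀⟩, hmin⟩ := minMono_isLeast n
  have hn0 : (0 : ℝ) ≤ n := n.cast_nonneg
  have htotal : ((triples n).card : ℝ) ≤ (n : ℝ) ^ 2 / 4 + 2 * n := by
    rcases Nat.eq_zero_or_pos n with rfl | hn
    · simp [triples]
    · have hn : (1 : ℝ) ≤ n := by exact_mod_cast hn
      linarith [card_triples_le n]
  have hblock : ((monoTriples (blockColoring n)).card : ℝ) ≤ (n : ℝ) ^ 2 / 44 + 4 * n := by
    rcases Nat.eq_zero_or_pos n with rfl | hn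
    · simp [monoTriples, triples]
    · have hn : (1 : ℝ) ≤ n := by exact_mod_cast hn
      linarith [card_monoTriples_blockColoring_le n]
  have hle : (minMono n : ℝ) ≤ (monoTriples (blockColoring n)).card :=
    Nat.cast_le.2 (hmin ⟨_, rfl⟩)
  have hge : (n : ℝ) ^ 2 / 44 - 2 * n ≤ minMono n := hc₀ ▸ le_card_monoTriples c₀
  refine ⟨abs_le.2 ⟨by linarith, by linarith⟩, abs_le.2 ⟨by linarith, by linarith⟩, fun c => ?_⟩
  have hsplit : ((monoTriples c).card : ℝ) + (nonMonoTriples c).card = (triples n).card := by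
    exact_mod_cast card_filter_add_card_filter_not (s := triples n) _
  linarith [le_card_monoTriples c]
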